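/- Let $K$ be a field of characteristic zero, let $R=K[x_1,\dots,x_n]$ with the standard grading, and let $1\le k\le n$. For an ideal $I$ of $R$, let $\mathrm{In}(I)$ denote the initial ideal of $I$, generated by the leading monomials of the nonzero elements of $I$, with respect to the (graded) reverse lexicographic order with $x_1>x_2>\cdots>x_n$. A graded Artinian $K$-algebra $A=\bigoplus_{i\ge 0}A_i$ is said to have the $k$-strong Lefschetz property ($k$-SLP) if there exist linear elements $g_1,\dots,g_k\in A_1$ such that, for every $j=1,\dots,k$, the graded algebra $B=A/(g_1,\dots,g_{j-1})$ and the image $\ell$ of $g_j$ in $B_1$ have the following property: for all $i\ge 0$ and $s>0$ the multiplication map $\times\ell^{s}\colon B_i\to B_{i+s}$ has full rank, i.e. is injective or surjective. **Proposition.** Let $I$ be a graded ideal of $R$ such that $R/I$ is Artinian. If $R/\mathrm{In}(I)$ has the $k$-SLP, then $R/I$ has the $k$-SLP. -/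

import Mathlib

open MvPolynomial

attribute [local instance] MvPolynomial.gradedAlgebra

/-- The exponent vectors of monomials in `n` variables, to be ordered by the (graded) reverse
lexicographic order with `x₁ > x₂ > ⋯ > xₙ`. -/
@[ext]
structure DegRevLexExp (n : ℕ) where
  /-- the underlying exponent vector -/
  exp : Fin n →₀ ℕ

namespace DegRevLexExp

variable {n : ℕ}

/-- `DegRevLexExp n` is `Fin n →₀ ℕ` with another order. -/
def equiv (n : ℕ) : DegRevLexExp n ≃ (Fin n →₀ ℕ) where
  toFun := exp
  invFun := mk
  left_inv _ := rfl
  right_inv _ := rfl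

noncomputable instance : AddCommMonoid (DegRevLexExp n) := (equiv n).addCommMonoid

theorem exp_add (a b : DegRevLexExp n) : (a + b).exp = a.exp + b.exp := rfl

/-- Compare total degrees first; break ties by the lexicographic comparison of the exponents read
from the last variable to the first, reversed. `lt_iff` below is the usual description. -/
noncomputable def key (a : DegRevLexExp n) : ℕ ×ₗ (Lex (Fin n → ℕ))ᵒᵈ :=
  toLex (a.exp.degree, OrderDual.toDual (toLex fun i => a.exp i.rev))

theorem key_injective : Function.Injective (key (n := n)) := by
  intro a b h
  have h2 : (fun i : Fin n => a.exp i.rev) = fun i => b.exp i.rev := congrArg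
    (fun x : ℕ ×ₗ (Lex (Fin n → ℕ))ᵒᵈ => ofLex (OrderDual.ofDual (ofLex x).2)) h
  ext i
  simpa using congrFun h2 i.rev

noncomputable instance : LinearOrder (DegRevLexExp n) :=
  LinearOrder.lift' key key_injective

/-- `x^a < x^b` iff `deg a < deg b`, or the degrees agree and the last nonzero entry of
`b - a` is negative. -/
theorem lt_iff {a b : DegRevLexExp n} :
    a < b ↔ a.exp.degree < b.exp.degree ∨
      (a.exp.degree = b.exp.degree ∧
        ∃ i, b.exp i < a.exp i ∧ ∀ j, i < j → a.exp j = b.exp j) := by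
  change key a < key b ↔ _
  rw [key, key, Prod.Lex.toLex_lt_toLex]
  refine or_congr Iff.rfl (and_congr Iff.rfl ?_)
  rw [OrderDual.toDual_lt_toDual]
  constructor
  · rintro ⟨i, h1, h2⟩
    refine ⟨i.rev, h2, fun j hj => ?_⟩
    have := h1 j.rev (by simpa using Fin.rev_lt_rev.2 hj)
    simpa using this.symm
  · rintro ⟨i, h1, h2⟩
    refine ⟨i.rev, fun j hj => ?_, by simpa using h1⟩
    exact (h2 j.rev (by simpa using Fin.rev_lt_rev.2 hj)).symm

instance : IsOrderedAddMonoid (DegRevLexExp n) where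
  add_le_add_left a b h c := by
    rcases h.eq_or_lt with rfl | h
    · exact le_rfl
    · refine le_of_lt ?_
      rw [lt_iff] at h ⊢
      simpa [exp_add] using h

instance : WellFoundedLT (DegRevLexExp n) := by
  refine ⟨WellFounded.intro fun a => ?_⟩
  have hfin : {b : DegRevLexExp n | b < a}.Finite := by
    refine Set.Finite.subset
      ((Finsupp.finite_of_degree_le (σ := Fin n) a.exp.degree).preimage
        (f := equiv n) (equiv n).injective.injOn) fun b hb => ?_
    rcases lt_iff.1 hb with h | h
    · exact h.le
    · exact h.1.le
  have hwf : ({b : DegRevLexExp n | b < a}).WellFoundedOn (· < ·) := hfin.wellFoundedOn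
  refine Acc.intro a fun b hb => ?_
  refine hwf.induction hb (P := Acc (· < ·)) fun c hc ih => ?_
  exact Acc.intro c fun d hd => ih d (lt_trans hd hc) hd

end DegRevLexExp

/-- The reverse lexicographic order with `x₁ > x₂ > ⋯ > xₙ`, as a monomial order. -/
noncomputable def degRevLex (n : ℕ) : MonomialOrder (Fin n) where
  syn := DegRevLexExp n
  toSyn := { (DegRevLexExp.equiv n).symm with map_add' := fun _ _ => rfl }
  toSyn_monotone a b h := by
    rcases h.eq_or_lt with rfl | hlt
    · exact le_rfl
    · refine le_of_lt (DegRevLexExp.lt_iff.2 (Or.inl ?_))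
      obtain ⟨c, rfl⟩ := exists_add_of_le h
      have hc : c ≠ 0 := by rintro rfl; simp at hlt
      change a.degree < (a + c).degree
      have : c.degree ≠ 0 := by rwa [Ne, Finsupp.degree_eq_zero_iff]
      rw [map_add]; omega

/-- The initial ideal `In(I)` of `I` with respect to the reverse lexicographic order: the ideal
generated by the leading monomials of the nonzero elements of `I`. -/
noncomputable def initialIdeal {K : Type*} [Field K] {n : ℕ} (I : Ideal (MvPolynomial (Fin n) K)) :
    Ideal (MvPolynomial (Fin n) K) :=
  Ideal.span {m | ∃ f ∈ I, f ≠ 0 ∧ m = monomial ((degRevLex n).degree f) 1}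

section Lefschetz

variable {K A : Type*} [Field K] [CommRing A] [Algebra K A]

/-- The family of graded components of `A ⧸ J`: the images of the graded components of `A`. -/
def quotientGrading (𝒜 : ℕ → Submodule K A) (J : Ideal A) : ℕ → Submodule K (A ⧸ J) :=
  fun i => (𝒜 i).map (Ideal.Quotient.mkₐ K J).toLinearMap

/-- `(A, ℓ)` has the strong Lefschetz property: `ℓ ∈ A₁`, and for all `i ≥ 0` and `s > 0` the
multiplication map `ℓ ^ s : A_i → A_{i+s}` has full rank, i.e. is injective or surjective. -/
def IsLefschetzElement (𝒜 : ℕ → Submodule K A) (l : A) : Prop :=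
  l ∈ 𝒜 1 ∧ ∀ i s : ℕ, 0 < s →
    Set.InjOn (fun f => l ^ s * f) (𝒜 i) ∨
      Set.SurjOn (fun f => l ^ s * f) (𝒜 i) (𝒜 (i + s))

/-- The `k`-strong Lefschetz property of `A` with graded components `𝒜`: there are
`g₁, …, g_k ∈ A₁` such that `(A/(g₁, …, g_{i-1}), g_i)` has the strong Lefschetz property for
every `i = 1, …, k`. For `i = 1` the ideal is zero. -/
def HasKSLP (𝒜 : ℕ → Submodule K A) (k : ℕ) : Prop :=
  ∃ g : Fin k → A, (∀ i, g i ∈ 𝒜 1) ∧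
    ∀ i, IsLefschetzElement (quotientGrading 𝒜 (Ideal.span (g '' {j | j < i})))
      (Ideal.Quotient.mk (Ideal.span (g '' {j | j < i})) (g i))

end Lefschetz

/-! Weights `1, N, N ^ 2, …` on the variables refine reverse lexicographic order in degrees below
`N`, so the substitutions `xᵢ ↦ t ^ (N ^ i) xᵢ` degenerate `I` to its initial ideal as `t → 0`.
Linear forms `g'` that work for `In(I)` are pulled back by the inverse substitution to linear forms
`g` for `I`.

Full rank of `l ^ s` modulo `J` is numerical: the dimension of `J + (l ^ s)` in degree `i + s`
attains an upper bound fixed by the Hilbert function of `J` (`Ideal.isFullRank_iff`). By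
semicontinuity (`finite_setOf_not_gradedRank_initialIdeal_sup_le`), for almost every `t` these
dimensions are at least as large for `I` and `g` as for `In(I)` and `g'`. If the Hilbert functions
agree modulo the earlier forms, the bound is therefore attained for `I` too, and the case `s = 1`
carries the agreement over to the next quotient (`isFullRank_and_gradedRank_eq_of_le`). The
induction starts from the equality of the Hilbert functions of `I` and `In(I)`. Since `R/I` is
Artinian only finitely many degrees matter, so one `t` in the infinite field `K` serves for all
conditions. -/

/-! ### Linear algebra: openness of independence, and a rank formula. -/

/-- A finite family of vectors depending polynomially on a parameter that is linearly independent
at the parameter `0` is linearly independent at all but finitely many parameters. -/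
theorem finite_setOf_not_linearIndependent_eval {K E ι : Type*} [Field K] [CommRing E]
    [Algebra K E] [Finite ι] (v : ι → Polynomial E)
    (h : LinearIndependent K fun b => (v b).eval 0) :
    {t : K | ¬ LinearIndependent K fun b => (v b).eval (algebraMap K E t)}.Finite := by
  classical
  have := Fintype.ofFinite ι
  obtain ⟨p, hp⟩ := LinearMap.exists_leftInverse_of_injective
    (Fintype.linearCombination K fun b => (v b).eval 0)
    (LinearMap.ker_eq_bot.2 (linearIndependent_iff_injective_fintypeLinearCombination.1 h))
  have hp' (b : ι) : p ((v b).eval 0) = Pi.single b 1 := by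
    simpa using LinearMap.congr_fun hp (Pi.single b 1)
  -- The left inverse `p` is only `K`-linear, so it is applied coefficientwise. The determinant is
  -- then a polynomial in `t` with value `1` at `0`, hence with finitely many roots.
  let M : Matrix ι ι (Polynomial K) := fun b a =>
    ∑ j ∈ (v b).support, Polynomial.monomial j (p ((v b).coeff j) a)
  have hM (t : K) (b a : ι) : (M b a).eval t = p ((v b).eval (algebraMap K E t)) a := by
    simp only [M, Polynomial.eval_finsetSum, Polynomial.eval_monomial]
    rw [Polynomial.eval_eq_sum, Polynomial.sum_def, map_sum, Finset.sum_apply]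
    refine Finset.sum_congr rfl fun j _ => ?_
    rw [← map_pow, mul_comm _ (algebraMap K E _), ← Algebra.smul_def, map_smul, Pi.smul_apply,
      smul_eq_mul, mul_comm]
  have hdet (t : K) : M.det.eval t = (Matrix.of fun b => p ((v b).eval (algebraMap K E t))).det := by
    rw [← Polynomial.coe_evalRingHom, RingHom.map_det]
    congr 1
    ext b a
    exact hM t b a
  have h0 : M.det ≠ 0 := by
    intro h0
    have h1 := hdet 0
    rw [h0, map_zero] at h1
    have : (Matrix.of fun b => p ((v b).eval 0)) = (1 : Matrix ι ι K) := by
      ext b a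
      rw [Matrix.of_apply, hp', Matrix.one_eq_pi_single]
    rw [this] at h1
    simp at h1
  refine (Polynomial.finite_setOfPred_isRoot h0).subset fun t ht => ?_
  by_contra hroot
  refine ht (LinearIndependent.of_comp p ?_)
  exact Matrix.linearIndependent_rows_of_det_ne_zero
    fun hz => hroot ((hdet t).trans hz)

/-- Rank-nullity for the map `U → E/P` induced by `m`: its image is `(P + m U)/P` and its kernel is
`U ∩ m⁻¹ P`. -/
theorem finrank_sup_map_add_finrank_inf_comap {K E : Type*} [Field K] [AddCommGroup E] [Module K E]
    (U P : Submodule K E) [FiniteDimensional K U] [FiniteDimensional K P] (m : E →ₗ[K] E) :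
    Module.finrank K ↥(P ⊔ U.map m) + Module.finrank K ↥(U ⊓ P.comap m) =
      Module.finrank K P + Module.finrank K U := by
  have h1 := Submodule.finrank_sup_add_finrank_inf_eq P (U.map m)
  have h2 := LinearMap.finrank_range_add_finrank_ker (P.mkQ ∘ₗ m ∘ₗ U.subtype)
  have h3 := LinearMap.finrank_range_add_finrank_ker
    (P.mkQ ∘ₗ (P ⊔ U.map m).subtype)
  have h4 : LinearMap.range (P.mkQ ∘ₗ (P ⊔ U.map m).subtype) =
      LinearMap.range (P.mkQ ∘ₗ m ∘ₗ U.subtype) := by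
    simp only [LinearMap.range_comp, Submodule.range_subtype, Submodule.map_sup]
    simp
  have h5 : (LinearMap.ker (P.mkQ ∘ₗ (P ⊔ U.map m).subtype)).map (P ⊔ U.map m).subtype = P := by
    rw [LinearMap.ker_comp, Submodule.ker_mkQ, Submodule.map_comap_subtype]
    simp
  have h6 : (LinearMap.ker (P.mkQ ∘ₗ m ∘ₗ U.subtype)).map U.subtype = U ⊓ P.comap m := by
    rw [LinearMap.ker_comp, Submodule.ker_mkQ, Submodule.comap_comp, Submodule.map_comap_subtype]
  have h7 := congrArg (fun S : Submodule K E => Module.finrank K S) h5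
  have h8 := congrArg (fun S : Submodule K E => Module.finrank K S) h6
  simp only [Submodule.finrank_map_subtype_eq] at h7 h8
  rw [h4] at h3
  omega

/-! ### Graded pieces of ideals and the numerical form of full rank. -/

section GradedPieces

variable {K : Type*} [Field K] {n : ℕ}

instance (d : ℕ) : FiniteDimensional K (homogeneousSubmodule (Fin n) K d) :=
  Module.Finite.iff_fg.2 (homogeneousSubmodule_fg _ _ d)

theorem coe_decompose_eq (f : MvPolynomial (Fin n) K) (d : ℕ) :
    (DirectSum.decompose (homogeneousSubmodule (Fin n) K) f d : MvPolynomial (Fin n) K) =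
      homogeneousComponent d f :=
  decomposition.decompose'_apply f d

/-- The degree `d` component of an ideal of the polynomial ring. -/
noncomputable def Ideal.gradedPiece (J : Ideal (MvPolynomial (Fin n) K)) (d : ℕ) :
    Submodule K (MvPolynomial (Fin n) K) :=
  J.restrictScalars K ⊓ homogeneousSubmodule (Fin n) K d

theorem Ideal.gradedPiece_le (J : Ideal (MvPolynomial (Fin n) K)) (d : ℕ) :
    J.gradedPiece d ≤ homogeneousSubmodule (Fin n) K d := inf_le_right

instance (J : Ideal (MvPolynomial (Fin n) K)) (d : ℕ) : FiniteDimensional K (J.gradedPiece d) :=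
  Submodule.finiteDimensional_of_le (J.gradedPiece_le d)

/-- The dimension of the degree `d` component of an ideal. -/
noncomputable def Ideal.gradedRank (J : Ideal (MvPolynomial (Fin n) K)) (d : ℕ) : ℕ :=
  Module.finrank K (J.gradedPiece d)

theorem Ideal.gradedRank_le (J : Ideal (MvPolynomial (Fin n) K)) (d : ℕ) :
    J.gradedRank d ≤ Module.finrank K (homogeneousSubmodule (Fin n) K d) :=
  Submodule.finrank_mono (J.gradedPiece_le d)

theorem Ideal.gradedPiece_mono {J J' : Ideal (MvPolynomial (Fin n) K)} (h : J ≤ J') (d : ℕ) :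
    J.gradedPiece d ≤ J'.gradedPiece d := inf_le_inf_right _ h

theorem Ideal.gradedRank_of_le {J : Ideal (MvPolynomial (Fin n) K)} {d : ℕ}
    (h : ∀ f ∈ homogeneousSubmodule (Fin n) K d, f ∈ J) :
    J.gradedRank d = Module.finrank K (homogeneousSubmodule (Fin n) K d) := by
  rw [gradedRank, le_antisymm (J.gradedPiece_le d) fun f hf => ⟨h f hf, hf⟩]

theorem Ideal.gradedPiece_sup {J J' : Ideal (MvPolynomial (Fin n) K)}
    (hJ : J.IsHomogeneous (homogeneousSubmodule (Fin n) K))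
    (hJ' : J'.IsHomogeneous (homogeneousSubmodule (Fin n) K)) (d : ℕ) :
    (J ⊔ J').gradedPiece d = J.gradedPiece d ⊔ J'.gradedPiece d := by
  refine le_antisymm ?_ (sup_le (gradedPiece_mono le_sup_left d) (gradedPiece_mono le_sup_right d))
  rintro f ⟨hf, hd⟩
  obtain ⟨p, hp, q, hq, rfl⟩ := Submodule.mem_sup.1 hf
  rw [← homogeneousComponent_eq_self hd, map_add]
  exact Submodule.add_mem_sup
    ⟨homogeneousComponent_mem_of_mem hJ hp d, homogeneousComponent_mem d p⟩
    ⟨homogeneousComponent_mem_of_mem hJ' hq d, homogeneousComponent_mem d q⟩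

theorem Ideal.isHomogeneous_span_singleton_pow {l : MvPolynomial (Fin n) K}
    (hl : l ∈ homogeneousSubmodule (Fin n) K 1) (s : ℕ) :
    (Ideal.span {l ^ s}).IsHomogeneous (homogeneousSubmodule (Fin n) K) := by
  refine Ideal.homogeneous_span _ _ ?_
  rintro _ rfl
  exact ⟨1 * s, IsHomogeneous.pow hl s⟩

theorem pow_mul_mem_homogeneousSubmodule {l q : MvPolynomial (Fin n) K} {i : ℕ}
    (hl : l ∈ homogeneousSubmodule (Fin n) K 1) (s : ℕ)
    (hq : q ∈ homogeneousSubmodule (Fin n) K i) :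
    l ^ s * q ∈ homogeneousSubmodule (Fin n) K (i + s) := by
  rw [mem_homogeneousSubmodule] at *
  simpa [add_comm] using (hl.pow s).mul hq

theorem Ideal.gradedPiece_span_singleton_pow {l : MvPolynomial (Fin n) K}
    (hl : l ∈ homogeneousSubmodule (Fin n) K 1) (i s : ℕ) :
    (Ideal.span {l ^ s}).gradedPiece (i + s) =
      (homogeneousSubmodule (Fin n) K i).map (LinearMap.mulLeft K (l ^ s)) := by
  have hls : l ^ s ∈ homogeneousSubmodule (Fin n) K s := by simpa using IsHomogeneous.pow hl s
  ext f
  constructor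
  · rintro ⟨hf, hd⟩
    obtain ⟨q, rfl⟩ := Ideal.mem_span_singleton'.1 hf
    refine ⟨homogeneousComponent i q, homogeneousComponent_mem i q, ?_⟩
    -- As `l ^ s` is homogeneous of degree `s`, only the degree `i` component of the cofactor
    -- contributes in degree `i + s`.
    have h := DirectSum.coe_decompose_mul_add_of_left_mem (homogeneousSubmodule (Fin n) K)
      (i := s) (j := i) (b := q) hls
    rw [coe_decompose_eq, coe_decompose_eq] at h
    rw [← homogeneousComponent_eq_self hd, LinearMap.mulLeft_apply, mul_comm q, add_comm i s]
    exact h.symm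
  · rintro ⟨q, hq, rfl⟩
    refine ⟨Ideal.mul_mem_right _ _ (Ideal.mem_span_singleton_self _), ?_⟩
    exact pow_mul_mem_homogeneousSubmodule hl s hq

theorem Ideal.gradedPiece_span_singleton_zero {l : MvPolynomial (Fin n) K}
    (hl : l ∈ homogeneousSubmodule (Fin n) K 1) : (Ideal.span {l}).gradedPiece 0 = ⊥ := by
  rw [eq_bot_iff]
  rintro f ⟨hf, hd⟩
  obtain ⟨q, rfl⟩ := Ideal.mem_span_singleton'.1 hf
  have h := DirectSum.coe_decompose_mul_of_left_mem_of_not_le (homogeneousSubmodule (Fin n) K)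
    (i := 1) (n := 0) (b := q) hl (by simp)
  rw [coe_decompose_eq] at h
  rw [Submodule.mem_bot, ← homogeneousComponent_eq_self hd, mul_comm q]
  exact h

/-- Multiplication by `l ^ s` on the quotient by `J`, from degree `i` to degree `i + s`, is
injective or surjective. -/
def Ideal.IsFullRank (J : Ideal (MvPolynomial (Fin n) K)) (l : MvPolynomial (Fin n) K)
    (i s : ℕ) : Prop :=
  (∀ q ∈ homogeneousSubmodule (Fin n) K i, l ^ s * q ∈ J → q ∈ J) ∨
    ∀ q ∈ homogeneousSubmodule (Fin n) K (i + s),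
      ∃ p ∈ homogeneousSubmodule (Fin n) K i, q - l ^ s * p ∈ J

/-- The Hilbert function of the quotient by an ideal. -/
noncomputable def Ideal.hilb (J : Ideal (MvPolynomial (Fin n) K)) (d : ℕ) : ℕ :=
  Module.finrank K (homogeneousSubmodule (Fin n) K d) - J.gradedRank d

theorem Ideal.gradedRank_add_hilb (J : Ideal (MvPolynomial (Fin n) K)) (d : ℕ) :
    J.gradedRank d + J.hilb d = Module.finrank K (homogeneousSubmodule (Fin n) K d) :=
  Nat.add_sub_cancel' (J.gradedRank_le d)

section FullRank

variable {J : Ideal (MvPolynomial (Fin n) K)} {l : MvPolynomial (Fin n) K}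

/-- Rank-nullity for multiplication by `l ^ s` from `R_i` to `R_{i+s}/J_{i+s}`. The rank is read off
from the ideal `J + (l ^ s)`, to which semicontinuity applies. -/
theorem Ideal.gradedRank_sup_span_pow
    (hJ : J.IsHomogeneous (homogeneousSubmodule (Fin n) K))
    (hl : l ∈ homogeneousSubmodule (Fin n) K 1) (i s : ℕ) :
    (J ⊔ Ideal.span {l ^ s}).gradedRank (i + s) +
      Module.finrank K ↥(homogeneousSubmodule (Fin n) K i ⊓
        (J.gradedPiece (i + s)).comap (LinearMap.mulLeft K (l ^ s))) =
      J.gradedRank (i + s) + Module.finrank K (homogeneousSubmodule (Fin n) K i) := by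
  rw [gradedRank, gradedPiece_sup hJ (isHomogeneous_span_singleton_pow hl s),
    gradedPiece_span_singleton_pow hl]
  exact finrank_sup_map_add_finrank_inf_comap _ _ _

theorem Ideal.gradedPiece_le_inf_comap
    (hl : l ∈ homogeneousSubmodule (Fin n) K 1) (i s : ℕ) :
    J.gradedPiece i ≤ homogeneousSubmodule (Fin n) K i ⊓
        (J.gradedPiece (i + s)).comap (LinearMap.mulLeft K (l ^ s)) := by
  rintro q ⟨hq, hd⟩
  exact ⟨hd, J.mul_mem_left _ hq, pow_mul_mem_homogeneousSubmodule hl s hd⟩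

/-- The rank of multiplication by `l ^ s` is at most the dimensions of its source and target. -/
theorem Ideal.gradedRank_sup_span_pow_le
    (hJ : J.IsHomogeneous (homogeneousSubmodule (Fin n) K))
    (hl : l ∈ homogeneousSubmodule (Fin n) K 1) (i s : ℕ) :
    (J ⊔ Ideal.span {l ^ s}).gradedRank (i + s) ≤
      J.gradedRank (i + s) + min (J.hilb i) (J.hilb (i + s)) := by
  have h1 := gradedRank_sup_span_pow hJ hl i s
  have h2 := Submodule.finrank_mono (gradedPiece_le_inf_comap (J := J) hl i s)
  have h3 := (J ⊔ Ideal.span {l ^ s}).gradedRank_le (i + s)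
  have h4 := J.gradedRank_add_hilb i
  have h5 := J.gradedRank_add_hilb (i + s)
  change J.gradedRank i ≤ _ at h2
  omega

/-- The rank on the quotient is at most both Hilbert values. It equals the first exactly when the
map is injective and the second exactly when it is surjective, so it equals their minimum exactly
when one of the two holds. -/
theorem Ideal.isFullRank_iff
    (hJ : J.IsHomogeneous (homogeneousSubmodule (Fin n) K))
    (hl : l ∈ homogeneousSubmodule (Fin n) K 1) (i s : ℕ) :
    J.IsFullRank l i s ↔ (J ⊔ Ideal.span {l ^ s}).gradedRank (i + s) =
      J.gradedRank (i + s) + min (J.hilb i) (J.hilb (i + s)) := by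
  have h1 := gradedRank_sup_span_pow hJ hl i s
  have h2 := gradedPiece_le_inf_comap (J := J) hl i s
  have h3 := (J ⊔ Ideal.span {l ^ s}).gradedPiece_le (i + s)
  have h4 := J.gradedRank_add_hilb i
  have h5 := J.gradedRank_add_hilb (i + s)
  have h6 := gradedRank_sup_span_pow_le hJ hl i s
  have hinj : (∀ q ∈ homogeneousSubmodule (Fin n) K i, l ^ s * q ∈ J → q ∈ J) ↔
      Module.finrank K ↥(homogeneousSubmodule (Fin n) K i ⊓
        (J.gradedPiece (i + s)).comap (LinearMap.mulLeft K (l ^ s))) = J.gradedRank i := by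
    constructor
    · intro h
      rw [gradedRank, le_antisymm h2]
      rintro q ⟨hd, hq⟩
      exact ⟨h q hd hq.1, hd⟩
    · intro h q hd hq
      have h7 := Submodule.eq_of_le_of_finrank_eq h2 h.symm
      have h8 : q ∈ J.gradedPiece i := by
        rw [h7]
        exact ⟨hd, hq, pow_mul_mem_homogeneousSubmodule hl s hd⟩
      exact h8.1
  have hsurj : (∀ q ∈ homogeneousSubmodule (Fin n) K (i + s),
      ∃ p ∈ homogeneousSubmodule (Fin n) K i, q - l ^ s * p ∈ J) ↔
      (J ⊔ Ideal.span {l ^ s}).gradedRank (i + s) =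
        Module.finrank K (homogeneousSubmodule (Fin n) K (i + s)) := by
    constructor
    · intro h
      refine gradedRank_of_le fun q hq => ?_
      obtain ⟨p, -, hp⟩ := h q hq
      rw [← sub_add_cancel q (l ^ s * p)]
      exact Submodule.add_mem_sup hp (Ideal.mul_mem_right _ _ (Ideal.mem_span_singleton_self _))
    · intro h q hq
      have h7 := Submodule.eq_of_le_of_finrank_eq h3 h
      rw [gradedPiece_sup hJ (isHomogeneous_span_singleton_pow hl s),
        gradedPiece_span_singleton_pow hl] at h7
      rw [← h7] at hq
      obtain ⟨a, ha, _, ⟨p, hp, rfl⟩, rfl⟩ := Submodule.mem_sup.1 hq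
      exact ⟨p, hp, by simpa using ha.1⟩
  rw [IsFullRank, hinj, hsurj]
  omega

end FullRank

end GradedPieces

/-! ### Initial ideals and their graded pieces. -/

section InitialIdeal

variable {K : Type*} [Field K] {n : ℕ}

theorem initialIdeal_eq_span_image (I : Ideal (MvPolynomial (Fin n) K)) :
    initialIdeal I = Ideal.span
      ((fun c => monomial c (1 : K)) '' {c | ∃ f ∈ I, f ≠ 0 ∧ (degRevLex n).degree f = c}) := by
  rw [initialIdeal]
  congr 1
  ext m
  constructor
  · rintro ⟨f, hf, h0, rfl⟩
    exact ⟨_, ⟨f, hf, h0, rfl⟩, rfl⟩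
  · rintro ⟨_, ⟨f, hf, h0, rfl⟩, rfl⟩
    exact ⟨f, hf, h0, rfl⟩

theorem isHomogeneous_initialIdeal (I : Ideal (MvPolynomial (Fin n) K)) :
    (initialIdeal I).IsHomogeneous (homogeneousSubmodule (Fin n) K) := by
  refine Ideal.homogeneous_span _ _ ?_
  rintro _ ⟨f, -, -, rfl⟩
  exact ⟨_, isHomogeneous_monomial _ rfl⟩

theorem monomial_degree_mem_initialIdeal {I : Ideal (MvPolynomial (Fin n) K)}
    {f : MvPolynomial (Fin n) K} (hf : f ∈ I) (h0 : f ≠ 0) :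
    monomial ((degRevLex n).degree f) (1 : K) ∈ initialIdeal I :=
  Ideal.subset_span ⟨f, hf, h0, rfl⟩

theorem monomial_mem_initialIdeal_of_mem_support {I : Ideal (MvPolynomial (Fin n) K)}
    {f : MvPolynomial (Fin n) K} (hf : f ∈ initialIdeal I) {c : Fin n →₀ ℕ} (hc : c ∈ f.support) :
    monomial c (1 : K) ∈ initialIdeal I := by
  rw [initialIdeal_eq_span_image] at hf ⊢
  obtain ⟨u, hu, huc⟩ := mem_ideal_span_monomial_image.1 hf c hc
  refine mem_ideal_span_monomial_image.2 fun b hb => ?_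
  rw [Finset.mem_singleton.1 (support_monomial_subset hb)]
  exact ⟨u, hu, huc⟩

/-- A monomial in the initial ideal of a homogeneous ideal `I` is the leading monomial of a
homogeneous element of `I`. -/
theorem exists_mem_gradedPiece_of_monomial_mem_initialIdeal {I : Ideal (MvPolynomial (Fin n) K)}
    (hI : I.IsHomogeneous (homogeneousSubmodule (Fin n) K)) {c : Fin n →₀ ℕ}
    (hc : monomial c (1 : K) ∈ initialIdeal I) :
    ∃ f ∈ I.gradedPiece c.degree, coeff c f = 1 ∧
      ∀ b ∈ f.support, b ≠ c → DegRevLexExp.mk b < DegRevLexExp.mk c := by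
  classical
  rw [initialIdeal_eq_span_image] at hc
  obtain ⟨_, ⟨f, hf, h0, rfl⟩, huc⟩ := mem_ideal_span_monomial_image.1 hc c (by simp)
  set u := (degRevLex n).degree f with hu
  have hcu : coeff u f ≠ 0 := MonomialOrder.coeff_degree_ne_zero_iff.2 h0
  -- Multiplying `f` by a scaled monomial moves its leading term to `c` with coefficient `1`, since
  -- the order is compatible with multiplication. Homogeneity of `I` allows passing to the component
  -- of degree `c.degree`.
  refine ⟨homogeneousComponent c.degree (monomial (c - u) (coeff u f)⁻¹ * f),
    ⟨homogeneousComponent_mem_of_mem hI (I.mul_mem_left _ hf) _, homogeneousComponent_mem _ _⟩,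
    ?_, fun b hb hbc => lt_of_le_of_ne ?_ fun h => hbc (congrArg DegRevLexExp.exp h)⟩
  · rw [coeff_homogeneousComponent, if_pos rfl, coeff_monomial_mul', if_pos tsub_le_self,
      tsub_tsub_cancel_of_le huc, inv_mul_cancel₀ hcu]
  · rw [mem_support_iff, coeff_homogeneousComponent, coeff_monomial_mul'] at hb
    split_ifs at hb with h1 h2
    · have h3 : b - (c - u) ∈ f.support := mem_support_iff.2 (right_ne_zero_of_mul hb)
      have h4 : DegRevLexExp.mk (b - (c - u)) ≤ DegRevLexExp.mk u :=
        (degRevLex n).le_degree h3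
      have h5 := add_le_add_right h4 (DegRevLexExp.mk (c - u))
      have h6 : DegRevLexExp.mk (c - u) + DegRevLexExp.mk (b - (c - u)) = DegRevLexExp.mk b :=
        DegRevLexExp.ext (add_tsub_cancel_of_le h2)
      have h7 : DegRevLexExp.mk (c - u) + DegRevLexExp.mk u = DegRevLexExp.mk c :=
        DegRevLexExp.ext (tsub_add_cancel_of_le huc)
      rwa [h6, h7] at h5
    · exact absurd rfl hb
    · exact absurd rfl hb

theorem gradedPiece_initialIdeal (I : Ideal (MvPolynomial (Fin n) K)) (d : ℕ) :
    (initialIdeal I).gradedPiece d = Submodule.span K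
      ((fun c => monomial c (1 : K)) '' {c | c.degree = d ∧ monomial c 1 ∈ initialIdeal I}) := by
  refine le_antisymm ?_ (Submodule.span_le.2 ?_)
  · rintro f ⟨hf, hd⟩
    rw [← support_sum_monomial_coeff f]
    refine Submodule.sum_mem _ fun c hc => ?_
    rw [show monomial c (coeff c f) = coeff c f • monomial c (1 : K) by simp [smul_monomial]]
    refine Submodule.smul_mem _ _ (Submodule.subset_span ⟨c, ⟨?_, ?_⟩, rfl⟩)
    · by_contra h
      exact mem_support_iff.1 hc (IsHomogeneous.coeff_eq_zero hd h)
    · exact monomial_mem_initialIdeal_of_mem_support hf hc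
  · rintro _ ⟨c, ⟨hc, hm⟩, rfl⟩
    exact ⟨hm, isHomogeneous_monomial _ hc⟩

/-- An element of `I_d` is determined by its coefficients at the monomials of the initial ideal: if
nonzero, it has its leading coefficient among them. -/
theorem gradedRank_le_gradedRank_initialIdeal (I : Ideal (MvPolynomial (Fin n) K)) (d : ℕ) :
    I.gradedRank d ≤ (initialIdeal I).gradedRank d := by
  let S : Set (Fin n →₀ ℕ) := {c | c.degree = d ∧ monomial c (1 : K) ∈ initialIdeal I}
  have hS : S.Finite := (Finsupp.finite_of_degree_le (σ := Fin n) d).subset fun c hc => hc.1.le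
  have := hS.fintype
  have hlin : LinearIndependent K fun c : S => monomial (c : Fin n →₀ ℕ) (1 : K) := by
    have := (basisMonomials (Fin n) K).linearIndependent.comp _ (Subtype.val_injective (p := S))
    rwa [coe_basisMonomials] at this
  have h1 : (initialIdeal I).gradedRank d = Fintype.card S := by
    rw [Ideal.gradedRank, gradedPiece_initialIdeal, ← finrank_span_eq_card hlin,
      Set.image_eq_range]
  let p : I.gradedPiece d →ₗ[K] (S → K) :=
    LinearMap.pi fun c => lcoeff K (c : Fin n →₀ ℕ) ∘ₗ (I.gradedPiece d).subtype
  have hp : Function.Injective p := by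
    rw [← LinearMap.ker_eq_bot, eq_bot_iff]
    rintro ⟨f, hf, hd⟩ hk
    by_contra h0
    have h0' : f ≠ 0 := fun h => h0 (by simp [h])
    have hcu : coeff ((degRevLex n).degree f) f ≠ 0 :=
      MonomialOrder.coeff_degree_ne_zero_iff.2 h0'
    refine hcu (congrFun (LinearMap.mem_ker.1 hk)
      ⟨(degRevLex n).degree f, ?_, monomial_degree_mem_initialIdeal hf h0'⟩)
    by_contra h
    exact hcu (IsHomogeneous.coeff_eq_zero hd h)
  rw [h1, ← Module.finrank_fintype_fun_eq_card K]
  exact LinearMap.finrank_le_finrank_of_injective hp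

end InitialIdeal

/-! ### The one-parameter degeneration and semicontinuity. -/

section Scaling

/-- The weight of an exponent vector for the weights `1, N, N ^ 2, …` of the variables. -/
def expWeight {n : ℕ} (N : ℕ) (c : Fin n →₀ ℕ) : ℕ := ∑ i, c i * N ^ (i : ℕ)

/-- In degrees below `N`, the weight refines the reverse lexicographic order, reversed. -/
theorem expWeight_lt_of_lt {n N : ℕ} {b c : Fin n →₀ ℕ} (hdeg : b.degree = c.degree)
    (hN : c.degree < N) (h : DegRevLexExp.mk b < DegRevLexExp.mk c) :
    expWeight N c < expWeight N b := by
  rcases DegRevLexExp.lt_iff.1 h with h | ⟨-, i, hi, hj⟩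
  · exact absurd hdeg h.ne
  dsimp only at hi hj
  have hsplit (a : Fin n →₀ ℕ) : expWeight N a =
      ∑ j with j < i, a j * N ^ (j : ℕ) + a i * N ^ (i : ℕ) +
        ∑ j with i < j, a j * N ^ (j : ℕ) := by
    rw [expWeight, ← Finset.sum_filter_add_sum_filter_not _ (· < i), add_assoc]
    congr 1
    rw [← Finset.sum_filter_add_sum_filter_not _ (fun j => j = i), Finset.filter_filter,
      Finset.filter_filter]
    congr 1
    · rw [← Finset.sum_singleton (fun j => a j * N ^ (j : ℕ)) i]
      refine Finset.sum_congr ?_ fun _ _ => rfl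
      ext j
      simp +contextual
    · refine Finset.sum_congr ?_ fun _ _ => rfl
      ext j
      simp only [Finset.mem_filter, Finset.mem_univ, true_and]
      omega
  -- As for base `N` digits, everything `c` has below position `i` is outweighed by the single extra
  -- `N ^ i` that `b` has there. Multiplying through by `N` avoids the exponent `i - 1`.
  have hlow : ∑ j with j < i, c j * N ^ (j : ℕ) < N ^ (i : ℕ) := by
    refine lt_of_mul_lt_mul_left' (a := N) ?_
    calc N * ∑ j with j < i, c j * N ^ (j : ℕ)
        = ∑ j with j < i, c j * N ^ (j + 1 : ℕ) := by
          rw [Finset.mul_sum]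
          exact Finset.sum_congr rfl fun j _ => by ring
      _ ≤ ∑ j with j < i, c j * N ^ (i : ℕ) := by
          refine Finset.sum_le_sum fun j hj => Nat.mul_le_mul_left _ ?_
          exact Nat.pow_le_pow_right (by omega) (by simpa using hj)
      _ ≤ ∑ j, c j * N ^ (i : ℕ) :=
          Finset.sum_le_sum_of_subset (Finset.filter_subset _ _)
      _ = c.degree * N ^ (i : ℕ) := by
          rw [← Finset.sum_mul, Finsupp.degree_eq_sum]
      _ < N * N ^ (i : ℕ) := Nat.mul_lt_mul_of_pos_right hN (Nat.pow_pos (by omega))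
  have hhigh : ∑ j with i < j, b j * N ^ (j : ℕ) = ∑ j with i < j, c j * N ^ (j : ℕ) :=
    Finset.sum_congr rfl fun j hj' => by rw [hj j (by simpa using hj')]
  have hmid : (c i + 1) * N ^ (i : ℕ) ≤ b i * N ^ (i : ℕ) := Nat.mul_le_mul_right _ hi
  rw [hsplit b, hsplit c, hhigh]
  have : (c i + 1) * N ^ (i : ℕ) = c i * N ^ (i : ℕ) + N ^ (i : ℕ) := by ring
  omega

variable {K : Type*} [Field K] {n : ℕ}

/-- The substitution `xᵢ ↦ t ^ (N ^ i) xᵢ`. -/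
noncomputable def scaleVars (n N : ℕ) (t : K) :
    MvPolynomial (Fin n) K →ₐ[K] MvPolynomial (Fin n) K :=
  aeval fun i => C (t ^ N ^ (i : ℕ)) * X i

theorem scaleVars_monomial (N : ℕ) (t : K) (c : Fin n →₀ ℕ) (a : K) :
    scaleVars n N t (monomial c a) = monomial c (t ^ expWeight N c * a) := by
  rw [scaleVars, aeval_monomial, monomial_eq (a := _ * a), Finsupp.prod_fintype _ _ (by simp),
    Finsupp.prod_fintype _ _ (by simp)]
  simp only [mul_pow, Finset.prod_mul_distrib, ← C_pow, ← pow_mul, algebraMap_eq, expWeight]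
  rw [← map_prod, ← mul_assoc, ← C_mul, Finset.prod_pow_eq_pow_sum, mul_comm a]
  simp only [mul_comm]

theorem coeff_scaleVars (N : ℕ) (t : K) (c : Fin n →₀ ℕ) (f : MvPolynomial (Fin n) K) :
    coeff c (scaleVars n N t f) = t ^ expWeight N c * coeff c f := by
  classical
  induction f using MvPolynomial.induction_on' with
  | monomial b a =>
    rw [scaleVars_monomial, coeff_monomial, coeff_monomial]
    split_ifs with h
    · rw [h]
    · rw [mul_zero]
  | add p q hp hq => rw [map_add, coeff_add, hp, hq, coeff_add, mul_add]

theorem scaleVars_scaleVars_inv (N : ℕ) {t : K} (ht : t ≠ 0) (f : MvPolynomial (Fin n) K) :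
    scaleVars n N t (scaleVars n N t⁻¹ f) = f := by
  ext c
  rw [coeff_scaleVars, coeff_scaleVars, ← mul_assoc, ← mul_pow, mul_inv_cancel₀ ht, one_pow,
    one_mul]

theorem scaleVars_mem_homogeneousSubmodule (N : ℕ) (t : K) {f : MvPolynomial (Fin n) K} {d : ℕ}
    (hf : f ∈ homogeneousSubmodule (Fin n) K d) :
    scaleVars n N t f ∈ homogeneousSubmodule (Fin n) K d := by
  intro c hc
  rw [coeff_scaleVars] at hc
  exact hf (right_ne_zero_of_mul hc)

/-- A monomial in the initial ideal of a homogeneous ideal `I` is a limit of rescaled elements of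
`I`. -/
theorem exists_polynomial_eval_zero_eq_monomial {I : Ideal (MvPolynomial (Fin n) K)}
    (hI : I.IsHomogeneous (homogeneousSubmodule (Fin n) K)) {N : ℕ} {u : Fin n →₀ ℕ}
    (hN : u.degree < N) (hu : monomial u (1 : K) ∈ initialIdeal I) :
    ∃ v : Polynomial (MvPolynomial (Fin n) K), v.eval 0 = monomial u 1 ∧
      ∀ t : K, t ≠ 0 → scaleVars n N t⁻¹ (v.eval (C t)) ∈ I.gradedPiece u.degree := by
  obtain ⟨f, hf, hcu, hlt⟩ := exists_mem_gradedPiece_of_monomial_mem_initialIdeal hI hu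
  have hdeg (c) (hc : c ∈ f.support) : c.degree = u.degree := by
    by_contra h
    exact mem_support_iff.1 hc (IsHomogeneous.coeff_eq_zero hf.2 h)
  have hw (c) (hc : c ∈ f.support) (hne : c ≠ u) : expWeight N u < expWeight N c :=
    expWeight_lt_of_lt (hdeg c hc) hN (hlt c hc hne)
  -- This is the rescaled `f` divided by `t ^ expWeight N u`. The leading exponent `u` has strictly
  -- least weight in the support, so the subtraction is never truncated and every other term
  -- vanishes at `t = 0`.
  refine ⟨∑ c ∈ f.support,
    Polynomial.monomial (expWeight N c - expWeight N u) (monomial c (coeff c f)), ?_, ?_⟩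
  · rw [Polynomial.eval_finsetSum, Finset.sum_eq_single u]
    · rw [Polynomial.eval_monomial, tsub_self, pow_zero, mul_one, hcu]
    · intro c hc hne
      have := hw c hc hne
      rw [Polynomial.eval_monomial, zero_pow (by omega), mul_zero]
    · intro h
      rw [notMem_support_iff.1 h, map_zero, map_zero, Polynomial.eval_zero]
  · intro t ht
    have : scaleVars n N t⁻¹ ((∑ c ∈ f.support,
        Polynomial.monomial (expWeight N c - expWeight N u) (monomial c (coeff c f))).eval (C t)) =
        (t ^ expWeight N u)⁻¹ • f := by
      conv_rhs => rw [← support_sum_monomial_coeff f]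
      rw [Polynomial.eval_finsetSum, map_sum, Finset.smul_sum]
      refine Finset.sum_congr rfl fun c hc => ?_
      rw [Polynomial.eval_monomial, ← C_pow, mul_comm, C_mul_monomial, scaleVars_monomial,
        smul_monomial, smul_eq_mul]
      congr 1
      have hle : expWeight N u ≤ expWeight N c := by
        by_cases h : c = u
        · rw [h]
        · exact (hw c hc h).le
      rw [pow_sub₀ t ht hle, inv_pow]
      field_simp
    rw [this]
    exact Submodule.smul_mem _ _ hf

/-- Semicontinuity of the Hilbert function along the degeneration of `I` to its initial ideal. -/
theorem finite_setOf_not_gradedRank_initialIdeal_sup_le {I J : Ideal (MvPolynomial (Fin n) K)}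
    (hI : I.IsHomogeneous (homogeneousSubmodule (Fin n) K))
    (hJ : J.IsHomogeneous (homogeneousSubmodule (Fin n) K)) {N d : ℕ} (hd : d < N) :
    {t : K | ¬ (initialIdeal I ⊔ J).gradedRank d ≤
      (I ⊔ J.map (scaleVars n N t⁻¹)).gradedRank d}.Finite := by
  let S : Set (MvPolynomial (Fin n) K) :=
    (fun c => monomial c (1 : K)) '' {c | c.degree = d ∧ monomial c 1 ∈ initialIdeal I} ∪
      J.gradedPiece d
  have hS : (initialIdeal I ⊔ J).gradedPiece d = Submodule.span K S := by
    rw [Ideal.gradedPiece_sup (isHomogeneous_initialIdeal I) hJ, gradedPiece_initialIdeal,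
      Submodule.span_union, Submodule.span_eq]
  -- A basis taken from the generators can be deformed vector by vector: monomials of `In(I)` along
  -- their curves, elements of `J` along constant ones.
  obtain ⟨B, hBS, hspan, hlin⟩ := exists_linearIndependent K S
  have hcurve (x : B) : ∃ v : Polynomial (MvPolynomial (Fin n) K), v.eval 0 = x ∧
      ∀ t : K, t ≠ 0 → scaleVars n N t⁻¹ (v.eval (C t)) ∈
        (I ⊔ J.map (scaleVars n N t⁻¹)).gradedPiece d := by
    rcases hBS x.2 with ⟨u, ⟨rfl, hu⟩, hux⟩ | hx
    · obtain ⟨v, hv, hvt⟩ := exists_polynomial_eval_zero_eq_monomial hI hd hu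
      exact ⟨v, hv.trans hux, fun t ht => Ideal.gradedPiece_mono le_sup_left _ (hvt t ht)⟩
    · refine ⟨Polynomial.C x, Polynomial.eval_C, fun t _ => ?_⟩
      rw [Polynomial.eval_C]
      exact Ideal.gradedPiece_mono le_sup_right _
        ⟨Ideal.mem_map_of_mem _ hx.1, scaleVars_mem_homogeneousSubmodule N _ hx.2⟩
  choose v hv0 hvt using hcurve
  have hrank : (initialIdeal I ⊔ J).gradedPiece d = Submodule.span K (Set.range ((↑) : B → _)) := by
    rw [hS, Subtype.range_coe, hspan]
  have hBfin : Finite B := by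
    have : FiniteDimensional K (Submodule.span K (Set.range ((↑) : B → MvPolynomial (Fin n) K))) :=
      hrank ▸ inferInstance
    exact Module.Finite.finite_basis (Module.Basis.span hlin)
  have := Fintype.ofFinite B
  have hcard : (initialIdeal I ⊔ J).gradedRank d = Fintype.card B := by
    rw [Ideal.gradedRank, hrank, finrank_span_eq_card hlin]
  have hfin := finite_setOf_not_linearIndependent_eval (K := K) v (by simpa only [hv0] using hlin)
  -- The value `t = 0` is discarded as well, because there the substitution need not be injective.
  refine (hfin.union (Set.finite_singleton 0)).subset fun t ht => ?_
  by_contra hcon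
  rw [Set.mem_union, not_or, Set.mem_ofPred_eq, not_not, Set.mem_singleton_iff] at hcon
  obtain ⟨hind, ht0⟩ := hcon
  refine ht ?_
  have hinj : Function.Injective (scaleVars n N t⁻¹).toLinearMap :=
    Function.LeftInverse.injective (g := scaleVars n N t) (scaleVars_scaleVars_inv N ht0)
  have hind' := hind.map' (scaleVars n N t⁻¹).toLinearMap (LinearMap.ker_eq_bot.2 hinj)
  rw [hcard, ← finrank_span_eq_card hind']
  refine Submodule.finrank_mono (Submodule.span_le.2 ?_)
  rintro _ ⟨x, rfl⟩
  exact hvt x t ht0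

end Scaling

/-! ### Transfer to the polynomial ring and comparison of Lefschetz properties. -/

section StrongLefschetz

variable {K : Type*} [Field K] {n : ℕ}

/-- Allowing any map with kernel `J` covers the twofold quotient `(R/I)/(g)` without identifying it
with a quotient of `R`. -/
theorem isLefschetzElement_map_iff {B : Type*} [CommRing B] [Algebra K B]
    (φ : MvPolynomial (Fin n) K →ₐ[K] B) {J : Ideal (MvPolynomial (Fin n) K)}
    (hJ : ∀ f, φ f = 0 ↔ f ∈ J) {l : MvPolynomial (Fin n) K}
    (hl : l ∈ homogeneousSubmodule (Fin n) K 1) :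
    IsLefschetzElement (fun i => (homogeneousSubmodule (Fin n) K i).map φ.toLinearMap) (φ l) ↔
      ∀ i s : ℕ, 0 < s → J.IsFullRank l i s := by
  refine (and_iff_right ⟨l, hl, rfl⟩).trans
    (forall_congr' fun i => forall_congr' fun s => imp_congr_right fun _ => or_congr ?_ ?_)
  · constructor
    · intro h q hq hlq
      refine (hJ q).1 (h ⟨q, hq, rfl⟩ ⟨0, Submodule.zero_mem _, map_zero _⟩ ?_)
      simpa using (hJ _).2 hlq
    · rintro h _ ⟨p, hp, rfl⟩ _ ⟨q, hq, rfl⟩ hpq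
      have h1 : φ (l ^ s * (p - q)) = 0 := by
        rw [map_mul, map_pow, map_sub, mul_sub]
        exact sub_eq_zero.2 hpq
      have h2 := (hJ _).2 (h _ (Submodule.sub_mem _ hp hq) ((hJ _).1 h1))
      rw [map_sub] at h2
      exact sub_eq_zero.1 h2
  · constructor
    · intro h q hq
      obtain ⟨_, ⟨p, hp, rfl⟩, hpq⟩ := h ⟨q, hq, rfl⟩
      refine ⟨p, hp, (hJ _).1 ?_⟩
      rw [map_sub, map_mul, map_pow]
      exact sub_eq_zero.2 hpq.symm
    · rintro h _ ⟨q, hq, rfl⟩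
      obtain ⟨p, hp, hpq⟩ := h q hq
      refine ⟨φ p, ⟨p, hp, rfl⟩, ?_⟩
      have := (hJ _).2 hpq
      rw [map_sub, map_mul, map_pow] at this
      exact (sub_eq_zero.1 this).symm

theorem isLefschetzElement_quotientGrading_iff (I : Ideal (MvPolynomial (Fin n) K))
    (S : Set (MvPolynomial (Fin n) K)) {l : MvPolynomial (Fin n) K}
    (hl : l ∈ homogeneousSubmodule (Fin n) K 1) :
    IsLefschetzElement
        (quotientGrading (quotientGrading (homogeneousSubmodule (Fin n) K) I)
          (Ideal.span (Ideal.Quotient.mk I '' S)))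
        (Ideal.Quotient.mk (Ideal.span (Ideal.Quotient.mk I '' S)) (Ideal.Quotient.mk I l)) ↔
      ∀ i s : ℕ, 0 < s → (I ⊔ Ideal.span S).IsFullRank l i s := by
  have := isLefschetzElement_map_iff
    (B := (MvPolynomial (Fin n) K ⧸ I) ⧸ Ideal.span (Ideal.Quotient.mk I '' S))
    ((Ideal.Quotient.mkₐ K (Ideal.span (Ideal.Quotient.mk I '' S))).comp (Ideal.Quotient.mkₐ K I))
    (J := I ⊔ Ideal.span S) (fun f => ?_) hl
  · rw [← this]
    have h (i : ℕ) : quotientGrading (quotientGrading (homogeneousSubmodule (Fin n) K) I)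
        (Ideal.span (Ideal.Quotient.mk I '' S)) i =
          (homogeneousSubmodule (Fin n) K i).map ((Ideal.Quotient.mkₐ K
            (Ideal.span (Ideal.Quotient.mk I '' S))).comp
              (Ideal.Quotient.mkₐ K I)).toLinearMap :=
      (Submodule.map_comp _ _ _).symm
    rw [← funext h]
    rfl
  · change Ideal.Quotient.mk _ (Ideal.Quotient.mk I f) = 0 ↔ _
    rw [Ideal.Quotient.eq_zero_iff_mem, ← Ideal.map_span, ← Ideal.mem_comap,
      Ideal.comap_map_of_surjective _ Ideal.Quotient.mk_surjective, ← RingHom.ker_eq_comap_bot,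
      Ideal.mk_ker, sup_comm]

theorem hasKSLP_quotientGrading_iff (I : Ideal (MvPolynomial (Fin n) K)) (k : ℕ) :
    HasKSLP (quotientGrading (homogeneousSubmodule (Fin n) K) I) k ↔
      ∃ g : Fin k → MvPolynomial (Fin n) K, (∀ j, g j ∈ homogeneousSubmodule (Fin n) K 1) ∧
        ∀ j, ∀ i s : ℕ, 0 < s →
          (I ⊔ Ideal.span (g '' {a | a < j})).IsFullRank (g j) i s := by
  constructor
  · rintro ⟨g, hg, h⟩
    choose p hp hpg using hg
    obtain rfl : (fun j => Ideal.Quotient.mk I (p j)) = g := funext hpg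
    refine ⟨p, hp, fun j => (isLefschetzElement_quotientGrading_iff I _ (hp j)).1 ?_⟩
    rw [Set.image_image]
    exact h j
  · rintro ⟨g, hg, h⟩
    refine ⟨fun j => Ideal.Quotient.mk I (g j), fun j => ⟨g j, hg j, rfl⟩, fun j => ?_⟩
    have := (isLefschetzElement_quotientGrading_iff I _ (hg j)).2 (h j)
    rw [Set.image_image] at this
    exact this

/-- With `𝔪` generated by the variables, the images of the powers `𝔪 ^ d` stabilise. A form of
degree `d` is then `p + q` with `p ∈ 𝔪 ^ (d + 1)` and `q ∈ I`; as `p` has no part of degree `d`, the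
form is the degree `d` component of `q`, which lies in `I`. -/
theorem exists_homogeneousSubmodule_le_of_isArtinianRing {I : Ideal (MvPolynomial (Fin n) K)}
    (hI : I.IsHomogeneous (homogeneousSubmodule (Fin n) K))
    (hA : IsArtinianRing (MvPolynomial (Fin n) K ⧸ I)) :
    ∃ N, ∀ d, N ≤ d → ∀ f ∈ homogeneousSubmodule (Fin n) K d, f ∈ I := by
  obtain ⟨N, hN⟩ := IsArtinian.monotone_stabilizes
    (R := MvPolynomial (Fin n) K ⧸ I) (M := MvPolynomial (Fin n) K ⧸ I)
    ⟨fun d => OrderDual.toDual ((idealOfVars (Fin n) K ^ d).map (Ideal.Quotient.mk I)),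
      fun a b hab => Ideal.map_mono (Ideal.pow_le_pow_right hab)⟩
  refine ⟨N, fun d hd f hf => ?_⟩
  have h1 : (idealOfVars (Fin n) K ^ d).map (Ideal.Quotient.mk I) =
      (idealOfVars (Fin n) K ^ (d + 1)).map (Ideal.Quotient.mk I) :=
    (hN d hd).symm.trans (hN (d + 1) (by omega))
  have h2 : f ∈ idealOfVars (Fin n) K ^ d := by
    rw [mem_pow_idealOfVars_iff]
    intro c hc
    by_contra h
    exact mem_support_iff.1 hc (IsHomogeneous.coeff_eq_zero hf (by omega))
  have h3 := Ideal.mem_map_of_mem (Ideal.Quotient.mk I) h2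
  rw [h1, ← Ideal.mem_comap, Ideal.comap_map_of_surjective _ Ideal.Quotient.mk_surjective,
    ← RingHom.ker_eq_comap_bot, Ideal.mk_ker] at h3
  obtain ⟨p, hp, q, hq, rfl⟩ := Submodule.mem_sup.1 h3
  rw [← homogeneousComponent_eq_self hf, map_add]
  have h4 : homogeneousComponent d p = 0 := by
    refine homogeneousComponent_eq_zero' _ _ fun c hc => ?_
    have := (mem_pow_idealOfVars_iff _ _).1 hp c hc
    omega
  rw [h4, zero_add]
  exact homogeneousComponent_mem_of_mem hI hq d

/-- One inequality is semicontinuity with `J = 0`, where an infinite field supplies a good `t`; the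
other comes from leading coefficients. -/
theorem gradedRank_initialIdeal [Infinite K] {I : Ideal (MvPolynomial (Fin n) K)}
    (hI : I.IsHomogeneous (homogeneousSubmodule (Fin n) K)) (d : ℕ) :
    (initialIdeal I).gradedRank d = I.gradedRank d := by
  refine le_antisymm ?_ (gradedRank_le_gradedRank_initialIdeal I d)
  obtain ⟨t, ht⟩ := (finite_setOf_not_gradedRank_initialIdeal_sup_le hI
    (Ideal.IsHomogeneous.bot _) (Nat.lt_succ_self d)).exists_notMem
  simpa [Ideal.map_bot] using ht

/-- If two graded quotients have the same Hilbert function, multiplication by powers of `l'` has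
full rank on the second, and the cokernels on the first are no larger, then multiplication by powers
of `l` has full rank on the first. -/
theorem isFullRank_and_gradedRank_eq_of_le {J J' : Ideal (MvPolynomial (Fin n) K)}
    (hJ : J.IsHomogeneous (homogeneousSubmodule (Fin n) K))
    (hJ' : J'.IsHomogeneous (homogeneousSubmodule (Fin n) K))
    {l l' : MvPolynomial (Fin n) K} (hl : l ∈ homogeneousSubmodule (Fin n) K 1)
    (hl' : l' ∈ homogeneousSubmodule (Fin n) K 1)
    (heq : ∀ d, J.gradedRank d = J'.gradedRank d)
    (hle : ∀ i s, (J' ⊔ Ideal.span {l' ^ s}).gradedRank (i + s) ≤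
      (J ⊔ Ideal.span {l ^ s}).gradedRank (i + s))
    (hfull : ∀ i s, 0 < s → J'.IsFullRank l' i s) :
    (∀ i s, 0 < s → J.IsFullRank l i s) ∧
      ∀ d, (J ⊔ Ideal.span {l}).gradedRank d = (J' ⊔ Ideal.span {l'}).gradedRank d := by
  have hhilb (d : ℕ) : J.hilb d = J'.hilb d := by rw [Ideal.hilb, Ideal.hilb, heq]
  -- The rank for `l` is squeezed between the rank for `l'`, which is maximal, and the common upper
  -- bound.
  have key (i s : ℕ) (hs : 0 < s) : (J ⊔ Ideal.span {l ^ s}).gradedRank (i + s) =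
      J.gradedRank (i + s) + min (J.hilb i) (J.hilb (i + s)) := by
    refine le_antisymm (Ideal.gradedRank_sup_span_pow_le hJ hl i s) ?_
    rw [heq, hhilb, hhilb, ← (Ideal.isFullRank_iff hJ' hl' i s).1 (hfull i s hs)]
    exact hle i s
  refine ⟨fun i s hs => (Ideal.isFullRank_iff hJ hl i s).2 (key i s hs), fun d => ?_⟩
  -- Full rank with `s = 1` only reaches degrees `i + 1`; in degree `0` a linear form adds nothing
  -- to the ideal.
  rcases d with _ | i
  · have h (a : MvPolynomial (Fin n) K) (ha : a ∈ homogeneousSubmodule (Fin n) K 1) :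
        (Ideal.span {a}).IsHomogeneous (homogeneousSubmodule (Fin n) K) := by
      simpa using Ideal.isHomogeneous_span_singleton_pow ha 1
    have h0 := heq 0
    rw [Ideal.gradedRank, Ideal.gradedRank] at h0 ⊢
    rwa [Ideal.gradedPiece_sup hJ (h l hl), Ideal.gradedPiece_sup hJ' (h l' hl'),
      Ideal.gradedPiece_span_singleton_zero hl, Ideal.gradedPiece_span_singleton_zero hl',
      sup_bot_eq, sup_bot_eq]
  · have h1 := key i 1 one_pos
    have h2 := (Ideal.isFullRank_iff hJ' hl' i 1).1 (hfull i 1 one_pos)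
    rw [heq, hhilb, hhilb, ← h2, pow_one, pow_one] at h1
    exact h1

theorem isHomogeneous_span_image {k : ℕ} {g : Fin k → MvPolynomial (Fin n) K}
    (hg : ∀ j, g j ∈ homogeneousSubmodule (Fin n) K 1) (S : Set (Fin k)) :
    (Ideal.span (g '' S)).IsHomogeneous (homogeneousSubmodule (Fin n) K) := by
  refine Ideal.homogeneous_span _ _ ?_
  rintro _ ⟨j, -, rfl⟩
  exact ⟨1, hg j⟩

theorem map_scaleVars_span_image_sup {k : ℕ} (N : ℕ) (t : K) (g : Fin k → MvPolynomial (Fin n) K)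
    (S : Set (Fin k)) (j : Fin k) (s : ℕ) :
    (Ideal.span (g '' S) ⊔ Ideal.span {g j ^ s}).map (scaleVars n N t) =
      Ideal.span ((fun a => scaleVars n N t (g a)) '' S) ⊔
        Ideal.span {scaleVars n N t (g j) ^ s} := by
  rw [Ideal.map_sup, Ideal.map_span, Ideal.map_span, Set.image_image, Set.image_singleton, map_pow]

end StrongLefschetz

/-! ### The proposition. -/

theorem mainTheorem4 {K : Type*} [Field K] [CharZero K] {n k : ℕ} (hk : 1 ≤ k) (hkn : k ≤ n)
    (I : Ideal (MvPolynomial (Fin n) K))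
    (hI : I.IsHomogeneous (homogeneousSubmodule (Fin n) K))
    (hA : IsArtinianRing (MvPolynomial (Fin n) K ⧸ I))
    (hin : HasKSLP (quotientGrading (homogeneousSubmodule (Fin n) K) (initialIdeal I)) k) :
    HasKSLP (quotientGrading (homogeneousSubmodule (Fin n) K) I) k := by
  rw [hasKSLP_quotientGrading_iff] at hin ⊢
  obtain ⟨g', hg', hfull⟩ := hin
  obtain ⟨N, hN⟩ := exists_homogeneousSubmodule_le_of_isArtinianRing hI hA
  -- The same `N` bounds the degrees to be tested and serves as base of the weights. Characteristic
  -- zero makes `K` infinite, so some `t` avoids this finite set.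
  have hbad := Set.finite_iUnion fun x : Fin k × Fin N × Fin N =>
    finite_setOf_not_gradedRank_initialIdeal_sup_le hI
      ((isHomogeneous_span_image hg' {a | a < x.1}).sup
        (Ideal.isHomogeneous_span_singleton_pow (hg' x.1) x.2.2)) x.2.1.2
  obtain ⟨t, ht⟩ := hbad.exists_notMem
  simp only [Set.mem_iUnion, Set.mem_ofPred_eq, not_exists, not_not, Prod.forall,
    map_scaleVars_span_image_sup, ← sup_assoc] at ht
  let g : Fin k → MvPolynomial (Fin n) K := fun j => scaleVars n N t⁻¹ (g' j)
  have hg (j) : g j ∈ homogeneousSubmodule (Fin n) K 1 :=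
    scaleVars_mem_homogeneousSubmodule N _ (hg' j)
  have hle (j : Fin k) (i s : ℕ) :
      (initialIdeal I ⊔ Ideal.span (g' '' {a | a < j}) ⊔ Ideal.span {g' j ^ s}).gradedRank (i + s) ≤
        (I ⊔ Ideal.span (g '' {a | a < j}) ⊔ Ideal.span {g j ^ s}).gradedRank (i + s) := by
    -- From degree `N` on, `I` is everything, so the inequality is automatic; below `N`, also `s <
    -- N`, and the choice of `t` applies.
    rcases lt_or_ge (i + s) N with h | h
    · exact ht j ⟨i + s, h⟩ ⟨s, by omega⟩
    · refine (Ideal.gradedRank_le _ _).trans_eq (Ideal.gradedRank_of_le fun f hf => ?_).symm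
      exact Ideal.mem_sup_left (Ideal.mem_sup_left (hN _ h f hf))
  have step (j : Fin k) (heq : ∀ d, (I ⊔ Ideal.span (g '' {a | a < j})).gradedRank d =
      (initialIdeal I ⊔ Ideal.span (g' '' {a | a < j})).gradedRank d) :=
    isFullRank_and_gradedRank_eq_of_le (hI.sup (isHomogeneous_span_image hg _))
      ((isHomogeneous_initialIdeal I).sup (isHomogeneous_span_image hg' _)) (hg j) (hg' j) heq
      (hle j) (hfull j)
  -- Each induction step adjoins one form to each ideal; `step` keeps the Hilbert functions equal.
  have hrank (m : ℕ) (hm : m ≤ k) (d : ℕ) :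
      (I ⊔ Ideal.span (g '' {a | (a : ℕ) < m})).gradedRank d =
        (initialIdeal I ⊔ Ideal.span (g' '' {a | (a : ℕ) < m})).gradedRank d := by
    induction m generalizing d with
    | zero => simp [gradedRank_initialIdeal hI]
    | succ m ih =>
      have hset : {a : Fin k | (a : ℕ) < m + 1} = {a : Fin k | (a : ℕ) < m} ∪ {⟨m, hm⟩} := by
        ext a
        simp only [Set.mem_ofPred_eq, Set.mem_union, Set.mem_singleton_iff, Fin.ext_iff]
        omega
      rw [hset, Set.image_union, Set.image_union, Set.image_singleton, Set.image_singleton,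
        Ideal.span_union, Ideal.span_union, ← sup_assoc, ← sup_assoc]
      exact (step ⟨m, hm⟩ (ih (by omega))).2 d
  exact ⟨g, hg, fun j => (step j (hrank j j.2.le)).1⟩
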